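/- Let $n,k\ge 1$ be integers, let $\ell_i,u_i\in\mathbb{Z}\cup\{\pm\infty\}$ for $i=1,\dots,n$, and put $$\mathcal{X}=\{x\in\mathbb{Z}^n:\ \ell_i\le x_i\le u_i\ \text{for all } i\},\qquad \overline{\mathcal{X}}=\{x\in\mathbb{R}^n:\ \ell_i\le x_i\le u_i\ \text{for all } i\}.$$ A function $f:\mathcal{X}\to\mathbb{R}$ is called $L^\natural$-convex if $$f(x)+f(y)\ \ge\ f\!\left(\left\lceil\tfrac{x+y}{2}\right\rceil\right)+f\!\left(\left\lfloor\tfrac{x+y}{2}\right\rfloor\right)\qquad\text{for all } x,y\in\mathcal{X},$$ with component-wise rounding. Its epigraph is $\mathcal{P}^f=\{(w,x)\in\mathbb{R}\times\mathcal{X}:\ w\ge f(x)\}\subseteq\mathbb{R}\times\mathbb{R}^n$. Let $f_1,\dots,f_k:\mathcal{X}\to\mathbb{R}$ be $L^\natural$-convex. (1) Let $\mathcal{Q}=\{(w,x)\in\mathbb{R}^k\times\mathcal{X}:\ w_i\ge f_i(x)\ \text{for all } i\}$. Then $$\operatorname{conv}(\mathcal{Q})=\{(w,x)\in\mathbb{R}^k\times\overline{\mathcal{X}}:\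 (w_i,x)\in\operatorname{conv}(\mathcal{P}^{f_i})\ \text{for all } i\}.$$ (2) Let $g_1,\dots,g_k:\mathcal{X}\to\mathbb{R}$ also be $L^\natural$-convex, and suppose that there is a function $h:\mathcal{X}\to\mathbb{R}$ with $h(x)=g_i(x)-f_i(x)$ for all $x\in\mathcal{X}$ and all $i$. Let $$\mathcal{Q}'=\{(\eta,w,x)\in\mathbb{R}^k\times\mathbb{R}^k\times\mathcal{X}:\ \eta_i\ge g_i(x),\ w_i\ge f_i(x),\ \eta_i-w_i=\eta_j-w_j\ \text{for all } i,j\}.$$ Then $\operatorname{conv}(\mathcal{Q}')$ is the set of all $(\eta,w,x)\in\mathbb{R}^k\times\mathbb{R}^k\times\overline{\mathcal{X}}$ such that $(\eta_i,x)\in\operatorname{conv}(\mathcal{P}^{g_i})$ and $(w_i,x)\in\operatorname{conv}(\mathcal{P}^{f_i})$ for all $i$, and $\eta_i-w_i=\eta_j-w_j$ for all $i,j$. -/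

import Mathlib

namespace LNat

/-- The integers extended by `-∞` (written `⊥`) and `+∞` (written `⊤`). -/
abbrev ExtInt : Type := WithBot (WithTop ℤ)

/-- An integer, seen as an extended integer. -/
def ofInt (m : ℤ) : ExtInt := ((m : WithTop ℤ) : WithBot (WithTop ℤ))

/-- The inclusion of the extended integers into the extended reals `[-∞, +∞]`. -/
noncomputable def toEReal : ExtInt → EReal
  | ⊥ => ⊥
  | some ⊤ => ⊤
  | some (some m) => ((m : ℝ) : EReal)

/-- The discrete hyperrectangle `𝒳 = {x ∈ ℤⁿ : ℓᵢ ≤ xᵢ ≤ uᵢ for all i}`, where the bounds may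
be infinite. -/
def discreteBox {n : ℕ} (l u : Fin n → ExtInt) : Set (Fin n → ℤ) :=
  {x | ∀ i, l i ≤ ofInt (x i) ∧ ofInt (x i) ≤ u i}

/-- The continuous relaxation `{x ∈ ℝⁿ : ℓᵢ ≤ xᵢ ≤ uᵢ for all i}` of the discrete
hyperrectangle. -/
def continuousBox {n : ℕ} (l u : Fin n → ExtInt) : Set (Fin n → ℝ) :=
  {x | ∀ i, toEReal (l i) ≤ (x i : EReal) ∧ (x i : EReal) ≤ toEReal (u i)}

/-- An integer vector, seen as a real vector. -/
def toReal {n : ℕ} (x : Fin n → ℤ) : Fin n → ℝ := fun i => (x i : ℝ)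

/-- The component-wise rounded-up midpoint `⌈(x + y) / 2⌉`. -/
noncomputable def midUp {n : ℕ} (x y : Fin n → ℤ) : Fin n → ℤ :=
  fun i => ⌈((x i : ℝ) + (y i : ℝ)) / 2⌉

/-- The component-wise rounded-down midpoint `⌊(x + y) / 2⌋`. -/
noncomputable def midDown {n : ℕ} (x y : Fin n → ℤ) : Fin n → ℤ :=
  fun i => ⌊((x i : ℝ) + (y i : ℝ)) / 2⌋

/-- `f` is `L♮`-convex on the set `X` of integer vectors (discrete midpoint convexity).
Only the values of `f` on `X` matter when `X` is a discrete hyperrectangle, since a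
hyperrectangle is closed under both rounded midpoints (`midUp_mem`, `midDown_mem`). -/
def LNatConvexOn {n : ℕ} (X : Set (Fin n → ℤ)) (f : (Fin n → ℤ) → ℝ) : Prop :=
  ∀ x ∈ X, ∀ y ∈ X, f (midUp x y) + f (midDown x y) ≤ f x + f y

/-- The epigraph `{(w, x) : x ∈ X, w ≥ f(x)}` of `f` over `X`, inside `ℝ × ℝⁿ`. -/
def epigraph {n : ℕ} (X : Set (Fin n → ℤ)) (f : (Fin n → ℤ) → ℝ) : Set (ℝ × (Fin n → ℝ)) :=
  {q | ∃ x ∈ X, q.2 = toReal x ∧ f x ≤ q.1}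

/-- The joint epigraph `𝒬 = {(w, x) : x ∈ X, wᵢ ≥ fᵢ(x) for all i}`, inside `ℝᵏ × ℝⁿ`. -/
def jointEpigraph {n k : ℕ} (X : Set (Fin n → ℤ)) (f : Fin k → (Fin n → ℤ) → ℝ) :
    Set ((Fin k → ℝ) × (Fin n → ℝ)) :=
  {q | ∃ x ∈ X, q.2 = toReal x ∧ ∀ i, f i x ≤ q.1 i}

/-- `𝒞𝒬`: the points `(w, x)` of `ℝᵏ × ℝⁿ` with `x` in the continuous relaxation and `(wᵢ, x)`
in the convex hull of the epigraph of `fᵢ`, for every `i`. -/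
def hullIntersection {n k : ℕ} (l u : Fin n → ExtInt) (f : Fin k → (Fin n → ℤ) → ℝ) :
    Set ((Fin k → ℝ) × (Fin n → ℝ)) :=
  {q | q.2 ∈ continuousBox l u ∧
    ∀ i, (q.1 i, q.2) ∈ convexHull ℝ (epigraph (discreteBox l u) (f i))}

/-- `𝒬'`: the points `(η, w, x)` with `x ∈ X`, `ηᵢ ≥ gᵢ(x)`, `wᵢ ≥ fᵢ(x)` for all `i`, and
`ηᵢ - wᵢ` the same for all `i`; inside `ℝᵏ × ℝᵏ × ℝⁿ`. -/
def pairedEpigraph {n k : ℕ} (X : Set (Fin n → ℤ)) (g f : Fin k → (Fin n → ℤ) → ℝ) :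
    Set ((Fin k → ℝ) × (Fin k → ℝ) × (Fin n → ℝ)) :=
  {q | (∃ x ∈ X, q.2.2 = toReal x ∧ (∀ i, g i x ≤ q.1 i) ∧ (∀ i, f i x ≤ q.2.1 i)) ∧
    ∀ i j, q.1 i - q.2.1 i = q.1 j - q.2.1 j}

/-- `𝒞𝒬'`: the points `(η, w, x)` with `x` in the continuous relaxation, `(ηᵢ, x)` and `(wᵢ, x)`
in the convex hulls of the epigraphs of `gᵢ` and `fᵢ`, and `ηᵢ - wᵢ` the same for all `i`. -/
def pairedHullIntersection {n k : ℕ} (l u : Fin n → ExtInt) (g f : Fin k → (Fin n → ℤ) → ℝ) :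
    Set ((Fin k → ℝ) × (Fin k → ℝ) × (Fin n → ℝ)) :=
  {q | q.2.2 ∈ continuousBox l u ∧
    (∀ i, (q.1 i, q.2.2) ∈ convexHull ℝ (epigraph (discreteBox l u) (g i))) ∧
    (∀ i, (q.2.1 i, q.2.2) ∈ convexHull ℝ (epigraph (discreteBox l u) (f i))) ∧
    ∀ i j, q.1 i - q.2.1 i = q.1 j - q.2.1 j}

theorem le_of_min_le {a : ExtInt} {x y z : ℤ} (hx : a ≤ ofInt x) (hy : a ≤ ofInt y)
    (h : min x y ≤ z) : a ≤ ofInt z := by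
  have hz : ofInt (min x y) ≤ ofInt z := WithBot.coe_le_coe.2 (WithTop.coe_le_coe.2 h)
  rcases min_choice x y with hm | hm <;> rw [hm] at hz
  · exact hx.trans hz
  · exact hy.trans hz

theorem le_of_le_max {a : ExtInt} {x y z : ℤ} (hx : ofInt x ≤ a) (hy : ofInt y ≤ a)
    (h : z ≤ max x y) : ofInt z ≤ a := by
  have hz : ofInt z ≤ ofInt (max x y) := WithBot.coe_le_coe.2 (WithTop.coe_le_coe.2 h)
  rcases max_choice x y with hm | hm <;> rw [hm] at hz
  · exact hz.trans hx
  · exact hz.trans hy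

theorem min_le_mid (x y : ℝ) : min x y ≤ (x + y) / 2 := by
  linarith [min_le_left x y, min_le_right x y]

theorem mid_le_max (x y : ℝ) : (x + y) / 2 ≤ max x y := by
  linarith [le_max_left x y, le_max_right x y]

theorem midDown_mem {n : ℕ} {l u : Fin n → ExtInt} {x y : Fin n → ℤ}
    (hx : x ∈ discreteBox l u) (hy : y ∈ discreteBox l u) : midDown x y ∈ discreteBox l u := by
  intro i
  have h1 : min (x i) (y i) ≤ midDown x y i :=
    Int.le_floor.2 (by push_cast; exact min_le_mid _ _)
  have h2 : midDown x y i ≤ max (x i) (y i) := by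
    have : (midDown x y i : ℝ) ≤ max (x i : ℝ) (y i) := (Int.floor_le _).trans (mid_le_max _ _)
    exact_mod_cast this
  exact ⟨le_of_min_le (hx i).1 (hy i).1 h1, le_of_le_max (hx i).2 (hy i).2 h2⟩

theorem midUp_mem {n : ℕ} {l u : Fin n → ExtInt} {x y : Fin n → ℤ}
    (hx : x ∈ discreteBox l u) (hy : y ∈ discreteBox l u) : midUp x y ∈ discreteBox l u := by
  intro i
  have h1 : min (x i) (y i) ≤ midUp x y i := by
    have : min (x i : ℝ) (y i) ≤ (midUp x y i : ℝ) := (min_le_mid _ _).trans (Int.le_ceil _)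
    exact_mod_cast this
  have h2 : midUp x y i ≤ max (x i) (y i) :=
    Int.ceil_le.2 (by push_cast; exact mid_le_max _ _)
  exact ⟨le_of_min_le (hx i).1 (hy i).1 h1, le_of_le_max (hx i).2 (hy i).2 h2⟩

/-- The integer points of the continuous relaxation are exactly the points of the discrete
hyperrectangle. -/
theorem toReal_mem_continuousBox {n : ℕ} {l u : Fin n → ExtInt} {x : Fin n → ℤ} :
    toReal x ∈ continuousBox l u ↔ x ∈ discreteBox l u := by
  have low : ∀ (a : ExtInt) (m : ℤ), toEReal a ≤ ((m : ℝ) : EReal) ↔ a ≤ ofInt m := by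
    rintro (_ | _ | b) m
    · exact ⟨fun _ => bot_le, fun _ => bot_le⟩
    · refine ⟨fun h => absurd h (not_le.2 (EReal.coe_lt_top _)), fun h => ?_⟩
      exact absurd (WithBot.coe_le_coe.1 h) (not_le.2 (WithTop.coe_lt_top m))
    · change ((b : ℝ) : EReal) ≤ _ ↔ ofInt b ≤ ofInt m
      rw [EReal.coe_le_coe_iff, Int.cast_le]
      exact (WithBot.coe_le_coe.trans WithTop.coe_le_coe).symm
  have upp : ∀ (a : ExtInt) (m : ℤ), ((m : ℝ) : EReal) ≤ toEReal a ↔ ofInt m ≤ a := by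
    rintro (_ | _ | b) m
    · refine ⟨fun h => absurd h (not_le.2 (EReal.bot_lt_coe _)), fun h => ?_⟩
      exact absurd h (not_le.2 (WithBot.bot_lt_coe _))
    · exact ⟨fun _ => le_top, fun _ => le_top⟩
    · change _ ≤ ((b : ℝ) : EReal) ↔ ofInt m ≤ ofInt b
      rw [EReal.coe_le_coe_iff, Int.cast_le]
      exact (WithBot.coe_le_coe.trans WithTop.coe_le_coe).symm
  exact forall_congr' fun i => and_congr (low _ _) (upp _ _)

end LNat

namespace LNat

open Finsupp (linearCombination single)

/-! A point of the hull of an epigraph is a probability weight on integer points, with mean `x`,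
whose `f`-mean lies below the height. The theorem holds because one weight minimises the means of
all `L♮`-convex functions at once, so separate hull memberships merge into one.

Existence of a chain: moving mass from `p`, `q` to their rounded midpoints keeps total and mean and
does not raise the `f`-mean. It strictly lowers the mean of `potential` unless `p`, `q` are `Near`,
so a potential-minimal weight is carried by pairwise near points (`exists_near`).

Uniqueness: two such weights with equal mean have mutually near supports (`IsWeight.near`), and
pairwise near points are affinely independent (`eq_zero_of_near`), so the weights coincide. The
chain weight thus depends on `x` alone, which gives `exists_optimal`. Adding constant slacks to the
heights then reaches every point of the right-hand sides. -/

/-- `p` and `q` are comparable and differ by at most one in each coordinate. -/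
def Near {n : ℕ} (p q : Fin n → ℤ) : Prop :=
  (∀ i, p i ≤ q i ∧ q i ≤ p i + 1) ∨ (∀ i, q i ≤ p i ∧ p i ≤ q i + 1)

theorem Near.symm {n : ℕ} {p q : Fin n → ℤ} (h : Near p q) : Near q p := Or.symm h

/-- Finitely supported probability weights on the integer points of `X` with mean `x`. -/
structure IsWeight {n : ℕ} (X : Set (Fin n → ℤ)) (x : Fin n → ℝ) (m : (Fin n → ℤ) →₀ ℝ) :
    Prop where
  nonneg : ∀ p, 0 ≤ m p
  mem : ∀ p, m p ≠ 0 → p ∈ X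
  total : linearCombination ℝ (fun _ => (1 : ℝ)) m = 1
  mean : ∀ i, linearCombination ℝ (fun p : Fin n → ℤ => (p i : ℝ)) m = x i

/-! ### Rounded midpoints and the potential -/

theorem midDown_eq {n : ℕ} (p q : Fin n → ℤ) (i : Fin n) : midDown p q i = (p i + q i) / 2 := by
  have h1 : 2 * ((p i + q i) / 2) ≤ p i + q i := by omega
  have h2 : p i + q i < 2 * ((p i + q i) / 2) + 2 := by omega
  generalize (p i + q i) / 2 = m at *
  have h1' : (2 * m : ℝ) ≤ p i + q i := by exact_mod_cast h1
  have h2' : (p i + q i : ℝ) < 2 * m + 2 := by exact_mod_cast h2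
  exact Int.floor_eq_iff.2 ⟨by linarith, by linarith⟩

theorem midUp_eq {n : ℕ} (p q : Fin n → ℤ) (i : Fin n) : midUp p q i = (p i + q i + 1) / 2 := by
  have h1 : 2 * ((p i + q i + 1) / 2) < p i + q i + 2 := by omega
  have h2 : p i + q i ≤ 2 * ((p i + q i + 1) / 2) := by omega
  generalize (p i + q i + 1) / 2 = m at *
  have h1' : (2 * m : ℝ) < p i + q i + 2 := by exact_mod_cast h1
  have h2' : (p i + q i : ℝ) ≤ 2 * m := by exact_mod_cast h2
  exact Int.ceil_eq_iff.2 ⟨by linarith, by linarith⟩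

theorem midUp_add_midDown {n : ℕ} (p q : Fin n → ℤ) (i : Fin n) :
    midUp p q i + midDown p q i = p i + q i := by
  rw [midDown_eq, midUp_eq]; omega

/-- A separable quadratic plus squared differences: a strictly `L♮`-convex function. -/
def potential {n : ℕ} (p : Fin n → ℤ) : ℤ := ∑ i, p i ^ 2 + ∑ i, ∑ j, (p i - p j) ^ 2

/-- For a fixed sum, the sum of squares grows with the square of the difference, whose parity is
fixed; a difference of at most one is therefore least. -/
theorem sq_add_sq_le {s s' t t' : ℤ} (h : s + s' = t + t') (hs : |s - s'| ≤ 1) :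
    s ^ 2 + s' ^ 2 ≤ t ^ 2 + t' ^ 2 := by
  have h1 : (s - s') ^ 2 ≤ (t - t') ^ 2 := by
    rcases eq_or_ne t t' with rfl | ht
    · rw [abs_le] at hs
      obtain rfl : s = s' := by omega
      simp
    · exact sq_le_sq.2 (hs.trans (Int.one_le_abs (sub_ne_zero.2 ht)))
  have h3 : (s + s') ^ 2 = (t + t') ^ 2 := by rw [h]
  nlinarith

theorem sq_add_sq_lt {s s' t t' : ℤ} (h : s + s' = t + t') (hs : |s - s'| ≤ 1)
    (ht : 2 ≤ |t - t'|) : s ^ 2 + s' ^ 2 < t ^ 2 + t' ^ 2 := by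
  have h1 : (s - s') ^ 2 ≤ 1 := by
    rw [← sq_abs]; nlinarith [abs_nonneg (s - s')]
  have h2 : 4 ≤ (t - t') ^ 2 := by
    rw [← sq_abs]; nlinarith
  have h3 : (s + s') ^ 2 = (t + t') ^ 2 := by rw [h]
  nlinarith

/-- Rounding balances every coordinate and every difference of two coordinates, so no square term
grows. Failure of `Near` means a gap of at least two in one coordinate, or gaps `+1` and `-1` in two
coordinates; the latter is a gap of two in their difference, which is why `potential` contains
differences. -/
theorem potential_mid_lt {n : ℕ} {p q : Fin n → ℤ} (h : ¬ Near p q) :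
    potential (midUp p q) + potential (midDown p q) < potential p + potential q := by
  have hsum := midUp_add_midDown p q
  have hdiff : ∀ i, 0 ≤ midUp p q i - midDown p q i ∧ midUp p q i - midDown p q i ≤ 1 := by
    intro i; rw [midDown_eq, midUp_eq]; omega
  have habs : ∀ i, |midUp p q i - midDown p q i| ≤ 1 := fun i => by
    rw [abs_le]; have := hdiff i; omega
  have hsum2 : ∀ i j, (midUp p q i - midUp p q j) + (midDown p q i - midDown p q j) =
      (p i - p j) + (q i - q j) := fun i j => by linarith [hsum i, hsum j]
  have habs2 : ∀ i j, |(midUp p q i - midUp p q j) - (midDown p q i - midDown p q j)| ≤ 1 :=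
    fun i j => by rw [abs_le]; have := hdiff i; have := hdiff j; omega
  have hle1 : ∀ i ∈ Finset.univ, midUp p q i ^ 2 + midDown p q i ^ 2 ≤ p i ^ 2 + q i ^ 2 :=
    fun i _ => sq_add_sq_le (hsum i) (habs i)
  have hle2 : ∀ i j, (midUp p q i - midUp p q j) ^ 2 + (midDown p q i - midDown p q j) ^ 2 ≤
      (p i - p j) ^ 2 + (q i - q j) ^ 2 :=
    fun i j => sq_add_sq_le (hsum2 i j) (habs2 i j)
  have hle3 : ∀ i ∈ Finset.univ,
      ∑ j, ((midUp p q i - midUp p q j) ^ 2 + (midDown p q i - midDown p q j) ^ 2) ≤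
      ∑ j, ((p i - p j) ^ 2 + (q i - q j) ^ 2) :=
    fun i _ => Finset.sum_le_sum fun j _ => hle2 i j
  have key : (∃ i, 2 ≤ |p i - q i|) ∨ ∃ i j, 2 ≤ |(p i - p j) - (q i - q j)| := by
    by_contra! hc
    obtain ⟨hc1, hc2⟩ := hc
    simp only [Near, not_or, not_forall] at h
    obtain ⟨⟨i, hi⟩, ⟨j, hj⟩⟩ := h
    have h1 := hc1 i
    have h2 := hc1 j
    have h3 := hc2 i j
    rw [abs_lt] at h1 h2 h3
    omega
  have e : ∀ a b : Fin n → ℤ, potential a + potential b =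
      ∑ i, (a i ^ 2 + b i ^ 2) + ∑ i, ∑ j, ((a i - a j) ^ 2 + (b i - b j) ^ 2) := by
    intro a b
    simp only [potential, Finset.sum_add_distrib]; ring
  rw [e, e]
  rcases key with ⟨i, hi⟩ | ⟨i, j, hij⟩
  · exact add_lt_add_of_lt_of_le
      (Finset.sum_lt_sum hle1 ⟨i, Finset.mem_univ i, sq_add_sq_lt (hsum i) (habs i) hi⟩)
      (Finset.sum_le_sum hle3)
  · exact add_lt_add_of_le_of_lt (Finset.sum_le_sum hle1)
      (Finset.sum_lt_sum hle3 ⟨i, Finset.mem_univ i, Finset.sum_lt_sum (fun j _ => hle2 i j)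
        ⟨j, Finset.mem_univ j, sq_add_sq_lt (hsum2 i j) (habs2 i j) hij⟩⟩)

/-! ### Uncrossing weights to a chain -/

/-- Replacing mass at `p` and `q` by mass at their rounded midpoints. -/
noncomputable def uncross {n : ℕ} (m : (Fin n → ℤ) →₀ ℝ) (e : ℝ) (p q : Fin n → ℤ) :
    (Fin n → ℤ) →₀ ℝ :=
  m + e • (single (midUp p q) 1 + single (midDown p q) 1 - single p 1 - single q 1)

theorem linearCombination_uncross {n : ℕ} (m : (Fin n → ℤ) →₀ ℝ) (e : ℝ) (p q : Fin n → ℤ)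
    (F : (Fin n → ℤ) → ℝ) :
    linearCombination ℝ F (uncross m e p q) =
      linearCombination ℝ F m + e * (F (midUp p q) + F (midDown p q) - F p - F q) := by
  simp [uncross]

theorem IsWeight.uncross {n : ℕ} {X : Set (Fin n → ℤ)} {x : Fin n → ℝ} {m : (Fin n → ℤ) →₀ ℝ}
    (hm : IsWeight X x m) {p q : Fin n → ℤ} (hpq : p ≠ q) (hu : midUp p q ∈ X)
    (hd : midDown p q ∈ X) {e : ℝ} (he : 0 ≤ e) (hp : e ≤ m p) (hq : e ≤ m q) :
    IsWeight X x (uncross m e p q) where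
  nonneg r := by
    have h0 := hm.nonneg r
    have h1 : 0 ≤ single (midUp p q) (1 : ℝ) r := by
      rw [Finsupp.single_apply]; split_ifs <;> norm_num
    have h2 : 0 ≤ single (midDown p q) (1 : ℝ) r := by
      rw [Finsupp.single_apply]; split_ifs <;> norm_num
    simp only [LNat.uncross, Finsupp.add_apply, Finsupp.smul_apply, Finsupp.sub_apply, smul_eq_mul]
    have h3 : 0 ≤ e * (single (midUp p q) (1 : ℝ) r + single (midDown p q) (1 : ℝ) r) := by
      positivity
    have h4 : e * (single p (1 : ℝ) r + single q (1 : ℝ) r) ≤ m r := by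
      rw [Finsupp.single_apply, Finsupp.single_apply]
      split_ifs with ha hb hb
      -- For `p = q` the mass `2 * e` would leave a single point, and `e ≤ m p` would not suffice.
      · exact absurd (ha.trans hb.symm) hpq
      · subst ha; linarith
      · subst hb; linarith
      · linarith
    linarith
  mem r hr := by
    by_contra hX
    have h0 : m r = 0 := by
      by_contra h; exact hX (hm.mem r h)
    have h1 : midUp p q ≠ r := fun h => hX (h ▸ hu)
    have h2 : midDown p q ≠ r := fun h => hX (h ▸ hd)
    rcases he.eq_or_lt with rfl | he
    · simp [LNat.uncross, h0] at hr
    have h3 : p ≠ r := fun h => by subst h; linarith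
    have h4 : q ≠ r := fun h => by subst h; linarith
    simp [LNat.uncross, h0, h1, h2, h3, h4] at hr
  total := by rw [linearCombination_uncross, hm.total]; ring
  mean i := by
    have h : (midUp p q i : ℝ) + midDown p q i = p i + q i := by
      exact_mod_cast midUp_add_midDown p q i
    rw [linearCombination_uncross, hm.mean, h]; ring

/-- Over a finite set closed under rounded midpoints, weights can be uncrossed so that their
support is a chain, without increasing the mean of an `L♮`-convex function. -/
theorem exists_near_of_finite {n : ℕ} (S : Finset (Fin n → ℤ))
    (hS : ∀ p ∈ S, ∀ q ∈ S, midUp p q ∈ S ∧ midDown p q ∈ S)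
    {f : (Fin n → ℤ) → ℝ} (hf : LNatConvexOn (S : Set (Fin n → ℤ)) f) {x : Fin n → ℝ}
    {m : (Fin n → ℤ) →₀ ℝ} (hm : IsWeight (S : Set (Fin n → ℤ)) x m) :
    ∃ m', IsWeight (S : Set (Fin n → ℤ)) x m' ∧ linearCombination ℝ f m' ≤ linearCombination ℝ f m ∧
      ∀ p q, m' p ≠ 0 → m' q ≠ 0 → Near p q := by
  set c := linearCombination ℝ f m
  have hE : ∀ (m : (Fin n → ℤ) →₀ ℝ), IsWeight (S : Set (Fin n → ℤ)) x m →
      ∀ F : (Fin n → ℤ) → ℝ, linearCombination ℝ F m = ∑ p ∈ S, m p * F p := by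
    intro m hm F
    rw [Finsupp.linearCombination_apply, Finsupp.sum_of_support_subset (s := S)]
    · simp
    · intro p hp
      exact hm.mem p (Finsupp.mem_support_iff.1 hp)
    · simp
  -- Admissible weights as plain functions: a closed subset of a product of intervals, hence
  -- compact. The bound on the `f`-mean is a constraint here, which leaves the potential as the
  -- objective.
  let K : Set ((Fin n → ℤ) → ℝ) := Set.univ.pi (fun _ => Set.Icc (0 : ℝ) 1) ∩
    ({w | ∀ p, p ∉ S → w p = 0} ∩ ({w | ∑ p ∈ S, w p * 1 = 1} ∩
    ({w | ∀ i, ∑ p ∈ S, w p * (p i : ℝ) = x i} ∩ {w | ∑ p ∈ S, w p * f p ≤ c})))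
  have hK : IsCompact K := by
    refine (isCompact_univ_pi fun _ => isCompact_Icc).inter_right
      (IsClosed.inter ?_ (IsClosed.inter ?_ (IsClosed.inter ?_ ?_)))
    · simp only [Set.ofPred_forall]
      exact isClosed_iInter fun p => isClosed_iInter fun _ =>
        isClosed_eq (continuous_apply p) continuous_const
    · exact isClosed_eq (by fun_prop) continuous_const
    · simp only [Set.ofPred_forall]
      exact isClosed_iInter fun i => isClosed_eq (by fun_prop) continuous_const
    · exact isClosed_le (by fun_prop) continuous_const
  have hmK : ∀ m : (Fin n → ℤ) →₀ ℝ, IsWeight (S : Set (Fin n → ℤ)) x m →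
      linearCombination ℝ f m ≤ c → (m : (Fin n → ℤ) → ℝ) ∈ K := by
    intro m hm hc
    have ht := hm.total
    rw [hE m hm] at ht
    have h0 : ∀ p, p ∉ S → m p = 0 := by
      intro p hp; by_contra h; exact hp (hm.mem p h)
    refine ⟨fun p _ => ⟨hm.nonneg p, ?_⟩, h0, ht, fun i => ?_, ?_⟩
    · by_cases hp : p ∈ S
      · rw [← ht]
        simp only [mul_one]
        exact Finset.single_le_sum (fun q _ => hm.nonneg q) hp
      · rw [h0 p hp]; exact zero_le_one
    · rw [← hm.mean i, hE m hm]
    · rw [hE m hm] at hc; exact hc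
  obtain ⟨w, hw, hmin⟩ := hK.exists_isMinOn ⟨m, hmK m hm le_rfl⟩
    (f := fun w => ∑ p ∈ S, w p * (potential p : ℝ)) (by fun_prop)
  obtain ⟨hw1, hw2, hw3, hw4, hw5⟩ := hw
  let m' : (Fin n → ℤ) →₀ ℝ := Finsupp.onFinset S w (fun p hp => by
    by_contra h; exact hp (hw2 p h))
  have hE' : ∀ F : (Fin n → ℤ) → ℝ, linearCombination ℝ F m' = ∑ p ∈ S, w p * F p := by
    intro F
    rw [Finsupp.linearCombination_apply, Finsupp.onFinset_sum] <;> simp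
  have hm' : IsWeight (S : Set (Fin n → ℤ)) x m' :=
    { nonneg := fun p => (hw1 p trivial).1
      mem := fun p hp => by by_contra h; exact hp (hw2 p h)
      total := by rw [hE']; exact hw3
      mean := fun i => by rw [hE']; exact hw4 i }
  have hc' : linearCombination ℝ f m' ≤ c := by rw [hE']; exact hw5
  refine ⟨m', hm', hc', fun p q hp hq => ?_⟩
  by_contra hnear
  have hpS : p ∈ S := hm'.mem p hp
  have hqS : q ∈ S := hm'.mem q hq
  have hne : p ≠ q := by
    rintro rfl; exact hnear (Or.inl fun i => ⟨le_rfl, by omega⟩)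
  have hp0 := (hm'.nonneg p).lt_of_ne' hp
  have hq0 := (hm'.nonneg q).lt_of_ne' hq
  -- The largest mass that can be moved; being positive, it makes the potential drop strictly while
  -- staying in `K`.
  have he : 0 < min (m' p) (m' q) := lt_min hp0 hq0
  have hw' := hm'.uncross hne (hS p hpS q hqS).1 (hS p hpS q hqS).2 he.le
    (min_le_left _ _) (min_le_right _ _)
  have hfle : linearCombination ℝ f (uncross m' (min (m' p) (m' q)) p q) ≤ c := by
    rw [linearCombination_uncross]
    have := hf p hpS q hqS
    nlinarith
  have h1 := isMinOn_iff.1 hmin _ (hmK _ hw' hfle)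
  rw [← hE _ hw', ← hE', linearCombination_uncross] at h1
  have h2 : (potential (midUp p q) + potential (midDown p q) : ℝ) < potential p + potential q := by
    exact_mod_cast potential_mid_lt hnear
  nlinarith

/-- Weights on a discrete hyperrectangle can be uncrossed to a chain. -/
theorem exists_near {n : ℕ} {l u : Fin n → ExtInt} {f : (Fin n → ℤ) → ℝ}
    (hf : LNatConvexOn (discreteBox l u) f) {x : Fin n → ℝ} {m : (Fin n → ℤ) →₀ ℝ}
    (hm : IsWeight (discreteBox l u) x m) :
    ∃ m', IsWeight (discreteBox l u) x m' ∧ linearCombination ℝ f m' ≤ linearCombination ℝ f m ∧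
      ∀ p q, m' p ≠ 0 → m' q ≠ 0 → Near p q := by
  classical
  obtain ⟨a, ha⟩ := m.support.bddBelow
  obtain ⟨b, hb⟩ := m.support.bddAbove
  -- Cutting the box by an integer interval containing the support makes it finite and keeps it
  -- closed under rounded midpoints.
  let S : Finset (Fin n → ℤ) := {p ∈ Finset.Icc a b | p ∈ discreteBox l u}
  have hSX : ∀ p ∈ S, p ∈ discreteBox l u := fun p hp => (Finset.mem_filter.1 hp).2
  have hS : ∀ p ∈ S, ∀ q ∈ S, midUp p q ∈ S ∧ midDown p q ∈ S := by
    intro p hp q hq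
    simp only [S, Finset.mem_filter, Finset.mem_Icc, Pi.le_def] at hp hq ⊢
    refine ⟨⟨⟨fun i => ?_, fun i => ?_⟩, midUp_mem hp.2 hq.2⟩,
      ⟨⟨fun i => ?_, fun i => ?_⟩, midDown_mem hp.2 hq.2⟩⟩ <;>
    · have := hp.1.1 i
      have := hp.1.2 i
      have := hq.1.1 i
      have := hq.1.2 i
      simp only [midUp_eq, midDown_eq]
      omega
  have hmS : IsWeight (S : Set (Fin n → ℤ)) x m :=
    { hm with
      mem := fun p hp => by
        have hp' : p ∈ m.support := Finsupp.mem_support_iff.2 hp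
        exact Finset.mem_filter.2 ⟨Finset.mem_Icc.2 ⟨ha hp', hb hp'⟩, hm.mem p hp⟩ }
  obtain ⟨m', h1, h2, h3⟩ := exists_near_of_finite S hS
    (fun p hp q hq => hf p (hSX p hp) q (hSX q hq)) hmS
  exact ⟨m', { h1 with mem := fun p hp => hSX p (h1.mem p hp) }, h2, h3⟩

/-! ### Compatibility of chains with the same mean -/

theorem linearCombination_sub_apply {α : Type*} (F G : α → ℝ) (m : α →₀ ℝ) :
    linearCombination ℝ (fun p => F p - G p) m =
      linearCombination ℝ F m - linearCombination ℝ G m := by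
  simp [Finsupp.linearCombination_apply, Finsupp.sum, mul_sub]

theorem linearCombination_const {α : Type*} (c : ℝ) (m : α →₀ ℝ) :
    linearCombination ℝ (fun _ => c) m = linearCombination ℝ (fun _ => (1 : ℝ)) m * c := by
  simp [Finsupp.linearCombination_apply, Finsupp.sum, Finset.sum_mul]

theorem IsWeight.linearCombination_add_const {n : ℕ} {X : Set (Fin n → ℤ)} {x : Fin n → ℝ}
    {m : (Fin n → ℤ) →₀ ℝ} (hm : IsWeight X x m) (F : (Fin n → ℤ) → ℝ) (c : ℝ) :
    linearCombination ℝ (fun p => F p + c) m = linearCombination ℝ F m + c := by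
  have h := linearCombination_sub_apply F (fun _ => -c) m
  rw [linearCombination_const, hm.total] at h
  simpa using h

/-- The mean strictly exceeds a lower bound that is not attained everywhere. -/
theorem IsWeight.lt_linearCombination {n : ℕ} {X : Set (Fin n → ℤ)} {x : Fin n → ℝ}
    {m : (Fin n → ℤ) →₀ ℝ} (hm : IsWeight X x m) {F : (Fin n → ℤ) → ℝ} {c : ℝ}
    (hF : ∀ p, m p ≠ 0 → c ≤ F p) {q : Fin n → ℤ} (hq : m q ≠ 0) (hc : c < F q) :
    c < linearCombination ℝ F m := by
  have h := hm.linearCombination_add_const F (-c)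
  have hpos : 0 < linearCombination ℝ (fun p => F p + -c) m := by
    rw [Finsupp.linearCombination_apply, Finsupp.sum]
    refine Finset.sum_pos' (fun p hp => ?_) ⟨q, Finsupp.mem_support_iff.2 hq, ?_⟩
    · have := hF p (Finsupp.mem_support_iff.1 hp)
      exact mul_nonneg (hm.nonneg p) (by linarith)
    · exact mul_pos ((hm.nonneg q).lt_of_ne' hq) (by linarith)
  linarith

/-- The points of a chain carrying weights with mean `x` lie within distance one of `x`. -/
theorem IsWeight.abs_sub_lt_one {n : ℕ} {X : Set (Fin n → ℤ)} {x : Fin n → ℝ}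
    {m : (Fin n → ℤ) →₀ ℝ} (hm : IsWeight X x m) (hnear : ∀ p q, m p ≠ 0 → m q ≠ 0 → Near p q)
    {p : Fin n → ℤ} (hp : m p ≠ 0) (i : Fin n) : |(p i : ℝ) - x i| < 1 := by
  have h1 : ∀ q, m q ≠ 0 → (p i : ℝ) - 1 ≤ q i ∧ (q i : ℝ) ≤ p i + 1 := by
    intro q hq
    have : p i - 1 ≤ q i ∧ q i ≤ p i + 1 := by
      rcases hnear p q hp hq with h | h <;> have := h i <;> omega
    exact ⟨by exact_mod_cast this.1, by exact_mod_cast this.2⟩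
  -- All values in coordinate `i` lie in `[p i - 1, p i + 1]`, and `p` itself attains neither end,
  -- so the mean is strictly inside.
  have h2 := hm.lt_linearCombination (F := fun q => (q i : ℝ)) (fun q hq => (h1 q hq).1) hp
    (by linarith)
  have h3 := hm.lt_linearCombination (F := fun q => 0 - (q i : ℝ)) (c := 0 - ((p i : ℝ) + 1))
    (fun q hq => by linarith [(h1 q hq).2]) hp (by linarith)
  rw [linearCombination_sub_apply, linearCombination_const, hm.mean] at h3
  rw [hm.mean] at h2
  rw [abs_lt]
  constructor <;> linarith

/-- Along a chain of weights, a point `p` below `q` in coordinate `j` but above it in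
coordinate `i` forces the mean to be larger in coordinate `i`, relative to `p`. -/
theorem IsWeight.sub_one_lt_mean_sub {n : ℕ} {X : Set (Fin n → ℤ)} {x : Fin n → ℝ}
    {m : (Fin n → ℤ) →₀ ℝ} (hm : IsWeight X x m) (hnear : ∀ p q, m p ≠ 0 → m q ≠ 0 → Near p q)
    {p : Fin n → ℤ} (hp : m p ≠ 0) {i j : Fin n} (hi : x i < p i) :
    (p i : ℝ) - p j - 1 < x i - x j := by
  have h := hm.lt_linearCombination (F := fun q => (q i : ℝ) - q j) (c := (p i : ℝ) - p j - 1)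
    (fun r hr => ?_) hp (by linarith)
  · rwa [linearCombination_sub_apply, hm.mean, hm.mean] at h
  · have hri := abs_lt.1 (hm.abs_sub_lt_one hnear hr i)
    have hr' : r i < p i + 1 := by
      have : (r i : ℝ) < p i + 1 := by linarith
      exact_mod_cast this
    -- Here `r i ≤ p i`. If `p ≤ r` then `r i = p i` and `r j ≤ p j + 1`; if `r ≤ p` then `r i ≥ p i
    -- - 1` and `r j ≤ p j`.
    have : p i - p j - 1 ≤ r i - r j := by
      rcases hnear p r hp hr with h | h <;> have := h i <;> have := h j <;> omega
    exact_mod_cast this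

/-- Two chains carrying weights with the same mean are compatible. -/
theorem IsWeight.near {n : ℕ} {X : Set (Fin n → ℤ)} {x : Fin n → ℝ}
    {m m' : (Fin n → ℤ) →₀ ℝ} (hm : IsWeight X x m) (hm' : IsWeight X x m')
    (hnear : ∀ p q, m p ≠ 0 → m q ≠ 0 → Near p q)
    (hnear' : ∀ p q, m' p ≠ 0 → m' q ≠ 0 → Near p q) {p q : Fin n → ℤ}
    (hp : m p ≠ 0) (hq : m' q ≠ 0) : Near p q := by
  have hb : ∀ i, p i < q i + 2 ∧ q i < p i + 2 := by
    intro i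
    have h1 := abs_lt.1 (hm.abs_sub_lt_one hnear hp i)
    have h2 := abs_lt.1 (hm'.abs_sub_lt_one hnear' hq i)
    have h3 : (p i : ℝ) < q i + 2 := by linarith
    have h4 : (q i : ℝ) < p i + 2 := by linarith
    exact ⟨by exact_mod_cast h3, by exact_mod_cast h4⟩
  by_contra h
  have key : (∃ i, q i < p i) ∧ ∃ j, p j < q j := by
    simp only [Near, not_or, not_forall] at h
    obtain ⟨⟨i, hi⟩, ⟨j, hj⟩⟩ := h
    exact ⟨⟨i, by have := hb i; omega⟩, ⟨j, by have := hb j; omega⟩⟩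
  obtain ⟨⟨i, hi⟩, ⟨j, hj⟩⟩ := key
  have hi' : (p i : ℝ) = q i + 1 := by
    have : p i = q i + 1 := by have := hb i; omega
    exact_mod_cast this
  have hj' : (q j : ℝ) = p j + 1 := by
    have : q j = p j + 1 := by have := hb j; omega
    exact_mod_cast this
  have hqi := abs_lt.1 (hm'.abs_sub_lt_one hnear' hq i)
  have hpj := abs_lt.1 (hm.abs_sub_lt_one hnear hp j)
  -- Since `x i < q i + 1 = p i` and `x j < p j + 1 = q j`, both strict bounds apply; their
  -- left-hand sides and their right-hand sides each sum to zero, a contradiction.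
  have h1 := hm.sub_one_lt_mean_sub hnear hp (i := i) (j := j) (by linarith)
  have h2 := hm'.sub_one_lt_mean_sub hnear' hq (i := j) (j := i) (by linarith)
  linarith

/-! ### Uniqueness of the chain weight and simultaneous optimality -/

/-- The points of a chain are affinely independent. -/
theorem eq_zero_of_near {n : ℕ} {c : (Fin n → ℤ) →₀ ℝ}
    (h1 : linearCombination ℝ (fun _ => (1 : ℝ)) c = 0)
    (h2 : ∀ i, linearCombination ℝ (fun p : Fin n → ℤ => (p i : ℝ)) c = 0)
    (hnear : ∀ p q, c p ≠ 0 → c q ≠ 0 → Near p q) : c = 0 := by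
  classical
  by_contra hc
  obtain ⟨p, hp⟩ := c.support.exists_maximal (Finsupp.support_nonempty_iff.2 hc)
  have hpc : c p ≠ 0 := Finsupp.mem_support_iff.1 hp.prop
  rcases (c.support.erase p).eq_empty_or_nonempty with he | hne
  · have h : ∀ r ∈ c.support, r ≠ p → c r • (1 : ℝ) = 0 := by
      intro r hr hrp
      exact absurd (Finset.mem_erase.2 ⟨hrp, hr⟩) (he ▸ Finset.notMem_empty r)
    rw [Finsupp.linearCombination_apply, Finsupp.sum, Finset.sum_eq_single_of_mem p hp.prop h] at h1
    exact hpc (by simpa using h1)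
  · obtain ⟨q, hq⟩ := (c.support.erase p).exists_maximal hne
    obtain ⟨hqp, hqc⟩ := Finset.mem_erase.1 hq.prop
    have hle : ∀ r, c r ≠ 0 → ∀ i, r i ≤ p i ∧ p i ≤ r i + 1 := by
      intro r hr i
      rcases hnear r p hr hpc with h | h
      · exact h i
      · exact ⟨hp.le_of_ge (Finsupp.mem_support_iff.2 hr) (fun i => (h i).1) i,
          (h i).1.trans (by omega)⟩
    have hle' : ∀ r, c r ≠ 0 → r ≠ p → ∀ i, r i ≤ q i := by
      intro r hr hrp i
      rcases hnear r q hr (Finsupp.mem_support_iff.1 hqc) with h | h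
      · exact (h i).1
      · exact hq.le_of_ge (Finset.mem_erase.2 ⟨hrp, Finsupp.mem_support_iff.2 hr⟩)
          (fun i => (h i).1) i
    -- With `p` the top and `q` the next point, every other `r` satisfies `p i - 1 ≤ r i ≤ q i < p
    -- i`, so `r i = q i`. In the sum of `c r * (r i - q i)`, which vanishes, only the term of `p`
    -- survives.
    obtain ⟨i, hi⟩ : ∃ i, q i < p i := by
      by_contra! h
      refine hqp (funext fun i => ?_)
      exact le_antisymm (hle q (Finsupp.mem_support_iff.1 hqc) i).1 (h i)
    have h3 := linearCombination_sub_apply (fun r : Fin n → ℤ => (r i : ℝ)) (fun _ => (q i : ℝ)) c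
    rw [h2, linearCombination_const, h1, Finsupp.linearCombination_apply, Finsupp.sum,
      Finset.sum_eq_single_of_mem p hp.prop] at h3
    · have hi' : (q i : ℝ) < p i := by exact_mod_cast hi
      have : c p * ((p i : ℝ) - q i) = 0 := by simpa using h3
      rcases mul_eq_zero.1 this with h | h
      · exact hpc h
      · linarith
    · intro r hr hrp
      have hr' := Finsupp.mem_support_iff.1 hr
      have : r i = q i := by
        have := hle r hr' i
        have := hle' r hr' hrp i
        omega
      simp [this]

/-- The difference `m - m'` has zero total and zero mean, and its support lies in the union of two
mutually compatible chains, so affine independence applies. -/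
theorem IsWeight.eq_of_near {n : ℕ} {X : Set (Fin n → ℤ)} {x : Fin n → ℝ}
    {m m' : (Fin n → ℤ) →₀ ℝ} (hm : IsWeight X x m) (hm' : IsWeight X x m')
    (hnear : ∀ p q, m p ≠ 0 → m q ≠ 0 → Near p q)
    (hnear' : ∀ p q, m' p ≠ 0 → m' q ≠ 0 → Near p q) : m = m' := by
  refine sub_eq_zero.1 (eq_zero_of_near ?_ (fun i => ?_) fun p q hp hq => ?_)
  · rw [map_sub, hm.total, hm'.total, sub_self]
  · rw [map_sub, hm.mean, hm'.mean, sub_self]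
  · have h : ∀ r, (m - m') r ≠ 0 → m r ≠ 0 ∨ m' r ≠ 0 := by
      intro r hr
      by_contra! h
      simp [h.1, h.2] at hr
    rcases h p hp with h1 | h1 <;> rcases h q hq with h2 | h2
    · exact hnear p q h1 h2
    · exact hm.near hm' hnear hnear' h1 h2
    · exact (hm.near hm' hnear hnear' h2 h1).symm
    · exact hnear' p q h1 h2

/-- A mean of points of a discrete hyperrectangle is attained by weights that minimise all
`L♮`-convex functions simultaneously. -/
theorem exists_optimal {n : ℕ} {l u : Fin n → ExtInt} {x : Fin n → ℝ}
    {m₀ : (Fin n → ℤ) →₀ ℝ} (hm₀ : IsWeight (discreteBox l u) x m₀) :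
    ∃ m, IsWeight (discreteBox l u) x m ∧ ∀ f, LNatConvexOn (discreteBox l u) f →
      ∀ m', IsWeight (discreteBox l u) x m' →
        linearCombination ℝ f m ≤ linearCombination ℝ f m' := by
  -- Only the chain property matters here. By uniqueness, uncrossing any `m'` for any `f` ends at
  -- this same `m`.
  obtain ⟨m, hm, -, hnear⟩ := exists_near (f := 0) (fun _ _ _ _ => by simp) hm₀
  refine ⟨m, hm, fun f hf m' hm' => ?_⟩
  obtain ⟨m'', h1, h2, h3⟩ := exists_near hf hm'
  rwa [hm.eq_of_near h1 hnear h3]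

/-! ### Convex hulls in terms of weights -/

/-- The pairs with such a weight form a convex set, and point masses show that it contains the
epigraph. -/
theorem exists_weight_of_mem_convexHull {n : ℕ} {X : Set (Fin n → ℤ)} {f : (Fin n → ℤ) → ℝ}
    {q : ℝ × (Fin n → ℝ)} (hq : q ∈ convexHull ℝ (epigraph X f)) :
    ∃ m, IsWeight X q.2 m ∧ linearCombination ℝ f m ≤ q.1 := by
  refine convexHull_min (t := {q | ∃ m, IsWeight X q.2 m ∧ linearCombination ℝ f m ≤ q.1})
    ?_ ?_ hq
  · rintro ⟨w, x⟩ ⟨p, hp, rfl, hw⟩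
    refine ⟨single p 1, ⟨fun r => ?_, fun r hr => ?_, by simp, fun i => by simp [toReal]⟩, ?_⟩
    · rw [Finsupp.single_apply]; split_ifs <;> norm_num
    · rw [Finsupp.single_apply] at hr
      split_ifs at hr with h
      · exact h ▸ hp
      · exact absurd rfl hr
    · simpa using hw
  · rintro ⟨w, x⟩ ⟨m, hm, hw⟩ ⟨w', x'⟩ ⟨m', hm', hw'⟩ a b ha hb hab
    refine ⟨a • m + b • m', ⟨fun r => ?_, fun r hr => ?_, ?_, fun i => ?_⟩, ?_⟩
    · exact add_nonneg (mul_nonneg ha (hm.nonneg r)) (mul_nonneg hb (hm'.nonneg r))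
    · by_contra hX
      have h1 : m r = 0 := by by_contra h; exact hX (hm.mem r h)
      have h2 : m' r = 0 := by by_contra h; exact hX (hm'.mem r h)
      simp [h1, h2] at hr
    · simp [map_add, map_smul, hm.total, hm'.total, hab]
    · simp [map_add, map_smul, hm.mean, hm'.mean]
    · simp only [map_add, map_smul, smul_eq_mul, Prod.fst_add, Prod.smul_fst]
      exact add_le_add (mul_le_mul_of_nonneg_left hw ha) (mul_le_mul_of_nonneg_left hw' hb)

theorem IsWeight.linearCombination_mem_convexHull {n : ℕ} {X : Set (Fin n → ℤ)} {x : Fin n → ℝ}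
    {m : (Fin n → ℤ) →₀ ℝ} (hm : IsWeight X x m) {E : Type*} [AddCommGroup E] [Module ℝ E]
    {s : Set E} {z : (Fin n → ℤ) → E} (hz : ∀ p ∈ X, z p ∈ s) :
    linearCombination ℝ z m ∈ convexHull ℝ s := by
  rw [Finsupp.linearCombination_apply, Finsupp.sum]
  refine (convex_convexHull ℝ s).sum_mem (fun p _ => hm.nonneg p) ?_ fun p hp =>
    subset_convexHull ℝ s (hz p (hm.mem p (Finsupp.mem_support_iff.1 hp)))
  have := hm.total
  rw [Finsupp.linearCombination_apply, Finsupp.sum] at this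
  simpa using this

theorem linearCombination_apply_pi {α ι : Type*} (F : α → ι → ℝ) (m : α →₀ ℝ) (i : ι) :
    linearCombination ℝ F m i = linearCombination ℝ (fun p => F p i) m := by
  simp [Finsupp.linearCombination_apply, Finsupp.sum, Finset.sum_apply]

theorem linearCombination_prodMk {α E E' : Type*} [AddCommGroup E] [Module ℝ E] [AddCommGroup E']
    [Module ℝ E'] (F : α → E) (G : α → E') (m : α →₀ ℝ) :
    linearCombination ℝ (fun p => (F p, G p)) m =
      (linearCombination ℝ F m, linearCombination ℝ G m) := by
  simp [Finsupp.linearCombination_apply, Finsupp.sum, Prod.ext_iff, Prod.fst_sum, Prod.snd_sum]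

theorem IsWeight.linearCombination_toReal {n : ℕ} {X : Set (Fin n → ℤ)} {x : Fin n → ℝ}
    {m : (Fin n → ℤ) →₀ ℝ} (hm : IsWeight X x m) : linearCombination ℝ toReal m = x := by
  funext i
  rw [linearCombination_apply_pi]
  exact hm.mean i

theorem convex_continuousBox {n : ℕ} (l u : Fin n → ExtInt) : Convex ℝ (continuousBox l u) := by
  intro x hx y hy a b ha hb hab i
  have h : (Set.Icc (toEReal (l i)) (toEReal (u i))).OrdConnected := Set.ordConnected_Icc
  have h' : (((↑) : ℝ → EReal) ⁻¹' Set.Icc (toEReal (l i)) (toEReal (u i))).OrdConnected :=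
    h.preimage_mono EReal.coe_strictMono.monotone
  exact h'.convex (hx i) (hy i) ha hb hab

theorem convex_hullIntersection {n k : ℕ} (l u : Fin n → ExtInt)
    (f : Fin k → (Fin n → ℤ) → ℝ) : Convex ℝ (hullIntersection l u f) := by
  intro q hq r hr a b ha hb hab
  exact ⟨convex_continuousBox l u hq.1 hr.1 ha hb hab,
    fun i => convex_convexHull ℝ _ (hq.2 i) (hr.2 i) ha hb hab⟩

theorem convex_pairedHullIntersection {n k : ℕ} (l u : Fin n → ExtInt)
    (g f : Fin k → (Fin n → ℤ) → ℝ) : Convex ℝ (pairedHullIntersection l u g f) := by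
  intro q hq r hr a b ha hb hab
  refine ⟨convex_continuousBox l u hq.1 hr.1 ha hb hab,
    fun i => convex_convexHull ℝ _ (hq.2.1 i) (hr.2.1 i) ha hb hab,
    fun i => convex_convexHull ℝ _ (hq.2.2.1 i) (hr.2.2.1 i) ha hb hab, fun i j => ?_⟩
  have h1 := hq.2.2.2 i j
  have h2 := hr.2.2.2 i j
  simp only [Prod.fst_add, Prod.smul_fst, Prod.snd_add, Prod.smul_snd, Pi.add_apply, Pi.smul_apply,
    smul_eq_mul]
  linear_combination a * h1 + b * h2

/-! ### The two hull identities -/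

theorem convexHull_jointEpigraph {n k : ℕ} (hk : 0 < k) (l u : Fin n → ExtInt)
    {f : Fin k → (Fin n → ℤ) → ℝ} (hf : ∀ i, LNatConvexOn (discreteBox l u) (f i)) :
    convexHull ℝ (jointEpigraph (discreteBox l u) f) = hullIntersection l u f := by
  apply Set.Subset.antisymm
  · refine convexHull_min ?_ (convex_hullIntersection l u f)
    rintro ⟨w, x⟩ ⟨p, hp, rfl, hw⟩
    exact ⟨toReal_mem_continuousBox.2 hp, fun i => subset_convexHull ℝ _ ⟨p, hp, rfl, hw i⟩⟩
  · rintro ⟨w, x⟩ ⟨-, hq⟩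
    -- One index is needed only to supply some weight with mean `x`.
    obtain ⟨m₀, hm₀, -⟩ := exists_weight_of_mem_convexHull (hq ⟨0, hk⟩)
    obtain ⟨m, hm, hopt⟩ := exists_optimal hm₀
    have hle : ∀ i, linearCombination ℝ (f i) m ≤ w i := fun i => by
      obtain ⟨m', hm', h⟩ := exists_weight_of_mem_convexHull (hq i)
      exact (hopt _ (hf i) m' hm').trans h
    -- The slack left by the optimal weight is nonnegative; adding it at every integer point makes
    -- the mean height exactly `w`.
    have h := hm.linearCombination_mem_convexHull (s := jointEpigraph (discreteBox l u) f)
      (z := fun p => (fun i => f i p + (w i - linearCombination ℝ (f i) m), toReal p))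
      (fun p hp => ⟨p, hp, rfl, fun i => by linarith [hle i]⟩)
    rw [linearCombination_prodMk, hm.linearCombination_toReal] at h
    convert h using 2
    funext i
    rw [linearCombination_apply_pi, hm.linearCombination_add_const]
    ring

theorem convexHull_pairedEpigraph {n k : ℕ} (hk : 0 < k) (l u : Fin n → ExtInt)
    {f g : Fin k → (Fin n → ℤ) → ℝ} (hf : ∀ i, LNatConvexOn (discreteBox l u) (f i))
    (hg : ∀ i, LNatConvexOn (discreteBox l u) (g i)) {h : (Fin n → ℤ) → ℝ}
    (hh : ∀ x ∈ discreteBox l u, ∀ i, h x = g i x - f i x) :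
    convexHull ℝ (pairedEpigraph (discreteBox l u) g f) = pairedHullIntersection l u g f := by
  apply Set.Subset.antisymm
  · refine convexHull_min ?_ (convex_pairedHullIntersection l u g f)
    rintro ⟨e, w, x⟩ ⟨⟨p, hp, rfl, he, hw⟩, hew⟩
    exact ⟨toReal_mem_continuousBox.2 hp, fun i => subset_convexHull ℝ _ ⟨p, hp, rfl, he i⟩,
      fun i => subset_convexHull ℝ _ ⟨p, hp, rfl, hw i⟩, hew⟩
  · rintro ⟨e, w, x⟩ ⟨-, hqg, hqf, hew⟩
    obtain ⟨m₀, hm₀, -⟩ := exists_weight_of_mem_convexHull (hqf ⟨0, hk⟩)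
    obtain ⟨m, hm, hopt⟩ := exists_optimal hm₀
    have hlef : ∀ i, linearCombination ℝ (f i) m ≤ w i := fun i => by
      obtain ⟨m', hm', h⟩ := exists_weight_of_mem_convexHull (hqf i)
      exact (hopt _ (hf i) m' hm').trans h
    have hleg : ∀ i, linearCombination ℝ (g i) m ≤ e i := fun i => by
      obtain ⟨m', hm', h⟩ := exists_weight_of_mem_convexHull (hqg i)
      exact (hopt _ (hg i) m' hm').trans h
    have hgf : ∀ i, linearCombination ℝ (g i) m - linearCombination ℝ (f i) m =
        linearCombination ℝ h m := by
      intro i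
      rw [← linearCombination_sub_apply, Finsupp.linearCombination_apply,
        Finsupp.linearCombination_apply]
      refine Finsupp.sum_congr fun p hp => ?_
      rw [hh p (hm.mem p (Finsupp.mem_support_iff.1 hp)) i]
    -- With both slacks added, the difference of the two heights over `p` is `h p + (e i - w i)`
    -- minus the mean of `h`, which does not depend on `i`.
    have key := hm.linearCombination_mem_convexHull (s := pairedEpigraph (discreteBox l u) g f)
      (z := fun p => (fun i => g i p + (e i - linearCombination ℝ (g i) m),
        fun i => f i p + (w i - linearCombination ℝ (f i) m), toReal p))
      (fun p hp => ⟨⟨p, hp, rfl, fun i => by linarith [hleg i], fun i => by linarith [hlef i]⟩,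
        fun i j => by
          have h1 := hew i j
          simp only at h1 ⊢
          linarith [hgf i, hgf j, hh p hp i, hh p hp j]⟩)
    rw [linearCombination_prodMk, linearCombination_prodMk, hm.linearCombination_toReal] at key
    convert key using 2
    · funext i
      rw [linearCombination_apply_pi, hm.linearCombination_add_const]
      ring
    · congr 1
      funext i
      rw [linearCombination_apply_pi, hm.linearCombination_add_const]
      ring

end LNat

theorem mainTheorem4 {n k : ℕ} (hn : 0 < n) (hk : 0 < k) (l u : Fin n → LNat.ExtInt)
    (f : Fin k → (Fin n → ℤ) → ℝ)
    (hf : ∀ i, LNat.LNatConvexOn (LNat.discreteBox l u) (f i)) :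
    convexHull ℝ (LNat.jointEpigraph (LNat.discreteBox l u) f) = LNat.hullIntersection l u f ∧
    ∀ g : Fin k → (Fin n → ℤ) → ℝ,
      (∀ i, LNat.LNatConvexOn (LNat.discreteBox l u) (g i)) →
      (∃ h : (Fin n → ℤ) → ℝ, ∀ x ∈ LNat.discreteBox l u, ∀ i, h x = g i x - f i x) →
      convexHull ℝ (LNat.pairedEpigraph (LNat.discreteBox l u) g f) =
        LNat.pairedHullIntersection l u g f :=
  ⟨LNat.convexHull_jointEpigraph hk l u hf,
    fun _ hg ⟨_, hh⟩ => LNat.convexHull_pairedEpigraph hk l u hf hg hh⟩
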